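/- **Theorem 3.1.** Let $\mathcal A,\mathcal B$ be abelian categories and let $\Phi:\mathcal A\to\mathcal B$, $\Psi:\mathcal B\to\mathcal A$ be additive contravariant functors forming a right adjoint pair, i.e. $\operatorname{Hom}_{\mathcal A}(A,\Psi B)\cong\operatorname{Hom}_{\mathcal B}(B,\Phi A)$ naturally in $A$ and $B$. Let each of $*$ and $\dagger$ be one of: no condition, $+$ (bounded below), $-$ (bounded above), $b$ (bounded); let $K^*(\mathcal A)$ be the homotopy category of complexes satisfying $*$ and $\mathcal D^*(\mathcal A)$ its derived category, regarded as the full subcategory of $\mathcal D(\mathcal A)$ of objects whose cohomology satisfies $*$. Assume that the right derived functors $R^*\Phi:\mathcal D^*(\mathcal A)\to\mathcal D(\mathcal B)$ and $R^\dagger\Psi:\mathcal D^\dagger(\mathcal B)\to\mathcal D(\mathcal A)$ exist and are (contravariant) triangulated functors, that they take values in $\mathcal D^\dagger(\mathcal B)$ and $\mathcal D^*(\mathcal A)$ respectively, and that the adjunction $(\Phi,\Psi)$ induces a right adjunction $(R^*\Phi,R^\dagger\Psi)$, with unit $\hat\eta:\mathrm{id}_{\mathcal D^*(\mathcal A)}\to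 R^\dagger\Psi R^*\Phi$. Here "induces" means: for $X\in K^*(\mathcal A)$, $Y\in K^\dagger(\mathcal B)$ and $g:Y\to\Phi X$ in $K(\mathcal B)$ with termwise adjoint $f:X\to\Psi Y$ in $K(\mathcal A)$, the composites $Y\xrightarrow{g}\Phi X\to R^*\Phi X$ and $X\xrightarrow{f}\Psi Y\to R^\dagger\Psi Y$ correspond to each other under the adjunction $(R^*\Phi,R^\dagger\Psi)$. An object $X$ of $\mathcal D^*(\mathcal A)$ is called *$\mathcal D$-reflexive* if $\hat\eta_X$ is an isomorphism, and an object of $\mathcal A$ is called $\mathcal D$-reflexive if it is so as a stalk complex in degree $0$. A covariant functor $F:\mathcal D^*(\mathcal A)\to\mathcal D(\mathcal A)$ is *way-out left* (resp. *way-out right*) if there is $n\in\mathbb Z$ such that, for every $X\in\mathcal D^*(\mathcal A)$ with $H^i(X)=0$ for all $i>0$ (resp. $i<0$), one has $H^i(FX)=0$ for all $i>n$ (resp. $i<n$). 1. If $X$ is a bounded complex all of whose terms are $\mathcal D$-reflexive, then $X$ is $\mathcal D$-reflexive. 2. If $X\in\mathcal D^*(\mathcal A)$ has bounded cohomology and every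 $H^i(X)$ is $\mathcal D$-reflexive, then $X$ is $\mathcal D$-reflexive. Assume that $R^\dagger\Psi R^*\Phi$ is way-out left (resp. way-out right). 3. If $X\in K^*(\mathcal A)$ is a bounded above (resp. bounded below) complex all of whose terms are $\mathcal D$-reflexive, then $X$ is $\mathcal D$-reflexive. 4. If $X\in\mathcal D^*(\mathcal A)$ has cohomology bounded above (resp. bounded below) and every $H^i(X)$ is $\mathcal D$-reflexive, then $X$ is $\mathcal D$-reflexive. Assume that $R^\dagger\Psi R^*\Phi$ is way-out left and way-out right. 5. If $X\in K^*(\mathcal A)$ is a complex all of whose terms are $\mathcal D$-reflexive, then $X$ is $\mathcal D$-reflexive. 6. If $X\in\mathcal D^*(\mathcal A)$ and every $H^i(X)$ is $\mathcal D$-reflexive, then $X$ is $\mathcal D$-reflexive. -/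

import Mathlib

open CategoryTheory CategoryTheory.Limits Opposite
open scoped CategoryTheory.Pretriangulated.Opposite

universe w₁ w₂ v₁ v₂ u₁ u₂

noncomputable section

namespace DReflexivity

/-- The boundedness condition `*` in the notations `K^*(A)`, `D^*(A)`:
no condition, bounded below (`+`), bounded above (`-`), or bounded (`b`). -/
inductive Bd
  | all
  | plus
  | minus
  | bounded

section Categories

variable (A : Type u₁) [Category.{v₁} A] [Abelian A]

/-- The cochain complexes whose terms satisfy the boundedness condition `*`. -/
def Bd.complexes : Bd → ObjectProperty (CochainComplex A ℤ)
  | .all => fun _ ↦ True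
  | .plus => fun K ↦ ∃ n : ℤ, K.IsStrictlyGE n
  | .minus => fun K ↦ ∃ n : ℤ, K.IsStrictlyLE n
  | .bounded => fun K ↦ (∃ n : ℤ, K.IsStrictlyGE n) ∧ ∃ n : ℤ, K.IsStrictlyLE n

/-- `K^*(A)`: the full subcategory of the homotopy category `K(A)` whose objects are the
complexes satisfying the boundedness condition `*`. -/
abbrev KStar (s : Bd) : Type _ :=
  ObjectProperty.FullSubcategory
    (fun X : HomotopyCategory A (ComplexShape.up ℤ) ↦ s.complexes A X.as)

variable [HasDerivedCategory.{w₁} A]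

/-- The objects of the derived category `D(A)` whose cohomology satisfies
the boundedness condition `*`. -/
def Bd.derived : Bd → ObjectProperty (DerivedCategory A)
  | .all => ⊤
  | .plus => DerivedCategory.TStructure.t.plus
  | .minus => DerivedCategory.TStructure.t.minus
  | .bounded => DerivedCategory.TStructure.t.bounded

instance (s : Bd) : (s.derived A).IsClosedUnderIsomorphisms := by
  cases s
  · exact ⟨fun _ _ ↦ trivial⟩
  · exact inferInstanceAs
      (DerivedCategory.TStructure.t (C := A)).plus.IsClosedUnderIsomorphisms
  · exact inferInstanceAs
      (DerivedCategory.TStructure.t (C := A)).minus.IsClosedUnderIsomorphisms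
  · exact inferInstanceAs
      (DerivedCategory.TStructure.t (C := A)).bounded.IsClosedUnderIsomorphisms

instance (s : Bd) : (s.derived A).IsTriangulated := by
  cases s
  · exact
      { exists_zero := ⟨_, isZero_zero (DerivedCategory A), trivial⟩
        isStableUnderShiftBy := fun _ ↦ ⟨fun _ _ ↦ trivial⟩
        toIsTriangulatedClosed₂ := .mk' (fun _ _ _ _ ↦ trivial) }
  · exact inferInstanceAs (DerivedCategory.TStructure.t (C := A)).plus.IsTriangulated
  · exact inferInstanceAs (DerivedCategory.TStructure.t (C := A)).minus.IsTriangulated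
  · exact inferInstanceAs (DerivedCategory.TStructure.t (C := A)).bounded.IsTriangulated

/-- `D^*(A)`, as a full triangulated subcategory of `D(A)`. -/
abbrev DStar (s : Bd) : Type _ := (s.derived A).FullSubcategory

/-- The inclusion `D^*(A) ⥤ D(A)`. -/
abbrev DStar.incl (s : Bd) : DStar A s ⥤ DerivedCategory A := (s.derived A).ι

variable {A}

lemma derived_Q_obj (s : Bd) (K : CochainComplex A ℤ) (hK : s.complexes A K) :
    s.derived A (DerivedCategory.Q.obj K) := by
  cases s
  · trivial
  · obtain ⟨n, hn⟩ := hK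
    exact ⟨n, ⟨K, Iso.refl _, hn⟩⟩
  · obtain ⟨n, hn⟩ := hK
    exact ⟨n, ⟨K, Iso.refl _, hn⟩⟩
  · obtain ⟨⟨n, hn⟩, ⟨m, hm⟩⟩ := hK
    exact ⟨⟨n, ⟨K, Iso.refl _, hn⟩⟩, ⟨m, ⟨K, Iso.refl _, hm⟩⟩⟩

lemma derived_Qh_obj (s : Bd) (X : KStar A s) :
    s.derived A (DerivedCategory.Qh.obj X.obj) :=
  (s.derived A).prop_of_iso ((DerivedCategory.quotientCompQhIso A).symm.app X.obj.as)
    (derived_Q_obj s X.obj.as X.property)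

variable (A)

/-- The localization functor `K^*(A) ⥤ D^*(A)`. -/
def DStar.Qh (s : Bd) : KStar A s ⥤ DStar A s :=
  (s.derived A).lift (ObjectProperty.ι _ ⋙ DerivedCategory.Qh) (derived_Qh_obj s)

variable {A}

end Categories

section Contravariant

variable {A : Type u₁} [Category.{v₁} A] [Abelian A]
  {B : Type u₂} [Category.{v₂} B] [Abelian B]

/-- The termwise extension of a contravariant additive functor `Φ` from `A` to `B` to cochain
complexes: `(Φ X)^n = Φ (X^{-n})`. -/
def mapCochain (Φ : Aᵒᵖ ⥤ B) [Φ.Additive] :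
    (CochainComplex A ℤ)ᵒᵖ ⥤ CochainComplex B ℤ :=
  (CochainComplex.opEquivalence A).functor ⋙ Φ.mapHomologicalComplex (ComplexShape.up ℤ)

/-- The extension `K(A)ᵒᵖ ⥤ K(B)` of a contravariant additive functor to the
homotopy categories. -/
def mapHtpy (Φ : Aᵒᵖ ⥤ B) [Φ.Additive] :
    (HomotopyCategory A (ComplexShape.up ℤ))ᵒᵖ ⥤ HomotopyCategory B (ComplexShape.up ℤ) :=
  (CategoryTheory.Quotient.lift (homotopic A (ComplexShape.up ℤ))
    ((mapCochain Φ ⋙ HomotopyCategory.quotient B (ComplexShape.up ℤ)).rightOp) (by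
      rintro K L f g ⟨h⟩
      exact Quiver.Hom.unop_inj (HomotopyCategory.eq_of_homotopy _ _
        (Φ.mapHomotopy (CochainComplex.homotopyOp h)))) :
    HomotopyCategory A (ComplexShape.up ℤ) ⥤
      (HomotopyCategory B (ComplexShape.up ℤ))ᵒᵖ).leftOp

section Derived

variable [HasDerivedCategory.{w₂} B]

/-- The functor `K^*(A)ᵒᵖ ⥤ D(B)` induced by `Φ`, whose right derived functor is `RΦ`. -/
def toDerived (Φ : Aᵒᵖ ⥤ B) [Φ.Additive] (s : Bd) : (KStar A s)ᵒᵖ ⥤ DerivedCategory B :=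
  (ObjectProperty.ι _).op ⋙ mapHtpy Φ ⋙ DerivedCategory.Qh

variable [HasDerivedCategory.{w₁} A]

/-- `(RΦ, α)` is the right derived functor of the contravariant functor `Φ` on `D^*(A)`:
`RΦ` is contravariant on `D^*(A)`, and the natural transformation `α`, with components
`Φ X ⟶ RΦ X` in `D(B)` for `X` in `K^*(A)`, is universal among natural transformations from
`Φ` to functors that factor through `K^*(A) ⥤ D^*(A)`. -/
def IsRightDerived (Φ : Aᵒᵖ ⥤ B) [Φ.Additive] (s : Bd)
    (RΦ : (DStar A s)ᵒᵖ ⥤ DerivedCategory B)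
    (α : toDerived Φ s ⟶ (DStar.Qh A s).op ⋙ RΦ) : Prop :=
  RΦ.IsLeftKanExtension α

end Derived

/-- The termwise extension `X ⟶ Ψ (Φ X)` of the unit of the adjunction
`Hom_B(N, Φ M) ≃ Hom_A(M, Ψ N)` to a cochain complex `X`; in degree `n` it is the unit
at `X^n = X^{-(-n)}`. -/
def unitCochain {Φ : Aᵒᵖ ⥤ B} {Ψ : Bᵒᵖ ⥤ A} [Φ.Additive] [Ψ.Additive]
    (adj : Φ.rightOp ⊣ Ψ) (X : CochainComplex A ℤ) :
    X ⟶ (mapCochain Ψ).obj (op ((mapCochain Φ).obj (op X))) where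
  f n := (X.XIsoOfEq (neg_neg n).symm).hom ≫ adj.unit.app (X.X (-(-n)))
  comm' i j hij := by
    have h := adj.unit.naturality (X.d (-(-i)) (-(-j)))
    have e : (X.XIsoOfEq (neg_neg i).symm).hom ≫ X.d (-(-i)) (-(-j)) =
        X.d i j ≫ (X.XIsoOfEq (neg_neg j).symm).hom := by simp
    exact (Category.assoc _ _ _).trans ((congrArg _ h.symm).trans
      ((Category.assoc _ _ _).symm.trans
        ((congrArg (fun k ↦ k ≫ adj.unit.app (X.X (-(-j)))) e).trans (Category.assoc _ _ _))))

end Contravariant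

section Adjoint

variable {A : Type u₁} [Category.{v₁} A] [Abelian A] [HasDerivedCategory.{w₁} A]
  {B : Type u₂} [Category.{v₂} B] [Abelian B] [HasDerivedCategory.{w₂} B]

/-- A contravariant functor `RΦ` from `D^*(A)` to `D(B)` with values in `D^†(B)`, seen as a functor
to `D^†(B)`. -/
abbrev corestrict {s t : Bd} (RΦ : (DStar A s)ᵒᵖ ⥤ DerivedCategory B)
    (hΦ : ∀ X, t.derived B (RΦ.obj X)) : (DStar A s)ᵒᵖ ⥤ DStar B t :=
  (t.derived B).lift RΦ hΦ

/-- The adjunction `Hom(Y, RΦ X) ≃ Hom(X, RΨ Y)` is induced by the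
adjunction between `Φ` and `Ψ`: for `X` in `K^*(A)`, `Y` in `K^†(B)` and `g : Y ⟶ Φ X` in `K(B)`
with adjoint `X ⟶ Ψ (Φ X) ⟶ Ψ Y` in `K(A)`, the morphism
`Y ⟶ Φ X ⟶ RΦ X` in `D(B)` has adjoint `X ⟶ Ψ Y ⟶ RΨ Y` in `D(A)`. -/
def IsInduced {Φ : Aᵒᵖ ⥤ B} {Ψ : Bᵒᵖ ⥤ A} [Φ.Additive] [Ψ.Additive]
    (adj : Φ.rightOp ⊣ Ψ) {s t : Bd}
    {RΦ : (DStar A s)ᵒᵖ ⥤ DerivedCategory B}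
    (α : toDerived Φ s ⟶ (DStar.Qh A s).op ⋙ RΦ)
    {RΨ : (DStar B t)ᵒᵖ ⥤ DerivedCategory A}
    (β : toDerived Ψ t ⟶ (DStar.Qh B t).op ⋙ RΨ)
    {hΦ : ∀ X, t.derived B (RΦ.obj X)} {hΨ : ∀ Y, s.derived A (RΨ.obj Y)}
    (Radj : (corestrict RΦ hΦ).rightOp ⊣ corestrict RΨ hΨ) : Prop :=
  ∀ (X : KStar A s) (Y : KStar B t) (g : Y.obj ⟶ (mapHtpy Φ).obj (op X.obj)),
    (Radj.unit.app ((DStar.Qh A s).obj X)).hom ≫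
        RΨ.map (Quiver.Hom.op (ObjectProperty.homMk
          (DerivedCategory.Qh.map g ≫ α.app (op X)) :
            (DStar.Qh B t).obj Y ⟶ (corestrict RΦ hΦ).obj (op ((DStar.Qh A s).obj X)))) =
      DerivedCategory.Qh.map
          ((HomotopyCategory.quotient A (ComplexShape.up ℤ)).map (unitCochain adj X.obj.as) ≫
            (mapHtpy Ψ).map g.op) ≫
        β.app (op Y)

/-- An object `Z` of `D(A)` is `D`-reflexive if it lies in `D^*(A)` and the unit `Z ⟶ RΨ (RΦ Z)`
of the adjunction of derived functors is an isomorphism. -/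
def IsDReflexive {s t : Bd} {F : (DStar A s)ᵒᵖ ⥤ DStar B t} {G : (DStar B t)ᵒᵖ ⥤ DStar A s}
    (Radj : F.rightOp ⊣ G) (Z : DerivedCategory A) : Prop :=
  ∃ hZ : s.derived A Z, IsIso (Radj.unit.app ⟨Z, hZ⟩)

/-- An object `M` of `A` is `D`-reflexive if it is so as a stalk complex in degree `0`. -/
def IsDReflexiveObj {s t : Bd} {F : (DStar A s)ᵒᵖ ⥤ DStar B t} {G : (DStar B t)ᵒᵖ ⥤ DStar A s}
    (Radj : F.rightOp ⊣ G) (M : A) : Prop :=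
  IsDReflexive Radj ((DerivedCategory.singleFunctor A 0).obj M)

/-- A covariant functor `F : D^*(A) ⥤ D(B)` is way-out left if for some `n`
it sends `D^*_{≤ 0}(A)` to `D_{≤ n}(B)`. -/
def WayOutLeft {s : Bd} (F : DStar A s ⥤ DerivedCategory B) : Prop :=
  ∃ n : ℤ, ∀ X : DStar A s, X.obj.IsLE 0 → (F.obj X).IsLE n

/-- A covariant functor `F : D^*(A) ⥤ D(B)` is way-out right if for some `n`
it sends `D^*_{≥ 0}(A)` to `D_{≥ n}(B)`. -/
def WayOutRight {s : Bd} (F : DStar A s ⥤ DerivedCategory B) : Prop :=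
  ∃ n : ℤ, ∀ X : DStar A s, X.obj.IsGE 0 → (F.obj X).IsGE n

end Adjoint

end DReflexivity

end

open DReflexivity

/-! Let `E` be the composite of the two derived functors, an endofunctor of `D^s(A)`, and let `η : 𝟭
⟶ E` be the unit. The left adjoint is triangulated, so `E` is triangulated and `η` commutes with
shifts. By the five lemma for triangles, the objects where `η` is an isomorphism form a triangulated
subcategory. Bounded complexes arise from shifted terms by finitely many extensions (brutal
truncations), and objects with bounded cohomology from their shifted cohomology objects (canonical
truncations). This settles the bounded cases: `prop_Q_obj`, `prop_of_homology`.

Without bounds, test `η` on each `H^i` separately. If `E` is way-out, a far enough truncation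
discards a piece `D` such that `D` and `E D` have no cohomology in the degrees affecting `H^i`.
Hence `H^i(η)` on `X` is an isomorphism as soon as it is one on the remaining part, and for `X`
bounded on the correct side that part is bounded (`reflexives_of_obj₁`, `reflexives_of_obj₃`). If
`E` is way-out on both sides, cut at degree `0` and apply the one-sided results to the two halves.
-/

open Pretriangulated

/-! ### Natural transformations and subcategories in triangulated categories -/

noncomputable section

namespace CategoryTheory

section

variable {C : Type*} [Category* C] [HasZeroObject C] [Preadditive C] [HasShift C ℤ]
  [∀ n : ℤ, (shiftFunctor C n).Additive] [Pretriangulated C]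

/-- The unit of an adjunction between contravariant functors is compatible with the shifts and
the composite endofunctor is triangulated, for a suitable commutation with the shifts, as soon as
one of the two functors is triangulated. -/
lemma Adjunction.exists_commShift_unit_rightOp {D : Type*} [Category* D] [HasZeroObject D]
    [Preadditive D] [HasShift D ℤ] [∀ n : ℤ, (shiftFunctor D n).Additive] [Pretriangulated D]
    {F : Cᵒᵖ ⥤ D} {G : Dᵒᵖ ⥤ C} (adj : F.rightOp ⊣ G) [F.CommShift ℤ] [F.IsTriangulated] :
    ∃ (_ : (F.rightOp ⋙ G).CommShift ℤ),
      (F.rightOp ⋙ G).IsTriangulated ∧ NatTrans.CommShift adj.unit ℤ := by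
  let : F.rightOp.CommShift ℤ := inferInstanceAs ((opOp C ⋙ F.op).CommShift ℤ)
  have : F.rightOp.IsTriangulated := inferInstanceAs ((opOp C ⋙ F.op).IsTriangulated)
  -- The shift isomorphisms of the right adjoint are obtained from those of the left adjoint through
  -- the adjunction, which makes the unit compatible with shifts.
  let := adj.rightAdjointCommShift ℤ
  have := adj.commShift_of_leftAdjoint ℤ
  have := adj.isTriangulated_rightAdjoint
  exact ⟨inferInstance, inferInstance, inferInstance⟩

/-- The objects at which a natural transformation is an isomorphism. -/
def NatTrans.isIsoLocus {E E' : C ⥤ C} (η : E ⟶ E') : ObjectProperty C :=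
  fun X ↦ IsIso (η.app X)

variable {E : C ⥤ C} (η : 𝟭 C ⟶ E)

instance : (NatTrans.isIsoLocus η).IsClosedUnderIsomorphisms where
  of_iso {X Y} e (h : IsIso _) := by
    have : η.app Y = e.inv ≫ η.app X ≫ E.map e.hom := by
      simpa using (e.inv ≫= η.naturality e.hom)
    change IsIso _
    rw [this]
    infer_instance

/-- Up to the shift isomorphisms of `E`, `η` at `X⟦n⟧` is the shift of `η` at `X`; on a
distinguished triangle `η` is a morphism of triangles, so the five lemma gives closure under
extensions. -/
instance [E.CommShift ℤ] [E.IsTriangulated] [NatTrans.CommShift η ℤ] :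
    (NatTrans.isIsoLocus η).IsTriangulated where
  exists_zero := by
    obtain ⟨Z, h⟩ := HasZeroObject.zero (C := C)
    exact ⟨Z, h, ⟨0, h.eq_of_src _ _, (E.map_isZero h).eq_of_src _ _⟩⟩
  isStableUnderShiftBy n :=
    { le_shift X (h : IsIso _) := by
        change IsIso (η.app (X⟦n⟧))
        rw [NatTrans.app_shift]
        dsimp
        infer_instance }
  toIsTriangulatedClosed₂ := .mk' fun T hT h₁ h₃ ↦ by
    let φ : T ⟶ E.mapTriangle.obj T :=
      { hom₁ := η.app _
        hom₂ := η.app _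
        hom₃ := η.app _
        comm₁ := η.naturality _
        comm₂ := η.naturality _
        -- Naturality at `T.mor₃` ends at `T.obj₁⟦1⟧`; compatibility of `η` with the shift turns
        -- this into the required square.
        comm₃ := by
          have h := η.naturality T.mor₃
          have h' := NatTrans.shift_app_comm η (1 : ℤ) T.obj₁
          have h'' : (η.app T.obj₁)⟦(1 : ℤ)⟧' = η.app (T.obj₁⟦(1 : ℤ)⟧) ≫
              (E.commShiftIso (1 : ℤ)).hom.app T.obj₁ := by
            rw [← h', Functor.commShiftIso_id_hom_app]
            exact (Category.id_comp _).symm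
          exact (congrArg (T.mor₃ ≫ ·) h'').trans ((Category.assoc _ _ _).symm.trans
            ((congrArg (· ≫ (E.commShiftIso (1 : ℤ)).hom.app T.obj₁) h).trans
              (Category.assoc _ _ _))) }
    exact isIso₂_of_isIso₁₃ φ hT (E.map_distinguished _ hT) h₁ h₃

namespace ObjectProperty

variable (P : ObjectProperty C) [P.IsTriangulated]

/-- A triangle with objects in a triangulated subcategory, seen as a triangle of this
subcategory. -/
def liftTriangle (T : Triangle C) (h₁ : P T.obj₁) (h₂ : P T.obj₂) (h₃ : P T.obj₃) :
    Triangle P.FullSubcategory :=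
  Triangle.mk (P.homMk T.mor₁ : ⟨_, h₁⟩ ⟶ ⟨_, h₂⟩) (P.homMk T.mor₂ : ⟨_, h₂⟩ ⟶ ⟨_, h₃⟩)
    (P.homMk (T.mor₃ ≫ (P.ι.commShiftIso (1 : ℤ)).inv.app ⟨T.obj₁, h₁⟩))

/-- This allows a functor defined only on the subcategory to be applied to `T`. The inclusion
recovers `T`, the shift isomorphism inserted in the third morphism cancelling. -/
lemma liftTriangle_distinguished (T : Triangle C) (hT : T ∈ distTriang C)
    (h₁ : P T.obj₁) (h₂ : P T.obj₂) (h₃ : P T.obj₃) :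
    P.liftTriangle T h₁ h₂ h₃ ∈ distTriang P.FullSubcategory :=
  isomorphic_distinguished _ hT _
    (Triangle.isoMk _ _ (Iso.refl _) (Iso.refl _) (Iso.refl _)
      ((Category.comp_id _).trans (Category.id_comp _).symm)
      ((Category.comp_id _).trans (Category.id_comp _).symm)
      ((congrArg (_ ≫ ·) (Functor.map_id _ _)).trans ((Category.comp_id _).trans
        ((Category.assoc _ _ _).trans ((congrArg (T.mor₃ ≫ ·) (Iso.inv_hom_id_app
          (P.ι.commShiftIso (1 : ℤ)) (⟨T.obj₁, h₁⟩ : P.FullSubcategory))).trans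
          ((Category.comp_id _).trans (Category.id_comp _).symm))))))

end ObjectProperty

end

end CategoryTheory

end

/-! ### Brutal truncations and the long exact homology sequence -/

noncomputable section

namespace CochainComplex

variable {A : Type u₁} [Category.{v₁} A] [Abelian A]

/-- The brutal truncations of a cochain complex, as a short exact sequence. -/
lemma exists_shortExact_brutalTruncation (K : CochainComplex A ℤ) (n : ℤ) :
    ∃ (K₁ K₃ : CochainComplex A ℤ) (f : K₁ ⟶ K) (g : K ⟶ K₃) (w : f ≫ g = 0),
      (ShortComplex.mk f g w).ShortExact ∧
      (∀ i ≤ n, IsZero (K₁.X i)) ∧ (∀ i, n < i → Nonempty (K₁.X i ≅ K.X i)) ∧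
      (∀ i, n < i → IsZero (K₃.X i)) ∧ (∀ i ≤ n, Nonempty (K₃.X i ≅ K.X i)) := by
  let e := ComplexShape.embeddingUpIntLE n
  -- The terms in degrees at most `n` form a quotient complex: the lifting condition concerns
  -- boundary degrees, and this embedding has none.
  have hlift : e.HasLift (𝟙 (K.restriction e)) := fun j hj ↦ hj.false_of_isTruncLE.elim
  let g := e.liftExtend _ hlift
  have hzero (i : ℤ) (hi : n < i) : IsZero (((K.restriction e).extend e).X i) :=
    HomologicalComplex.isZero_extend_X _ _ _ (fun j hj ↦ by
      simp [e] at hj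
      lia)
  have hiso (i : ℤ) (hi : i ≤ n) : IsIso (g.f i) := by
    obtain ⟨k, rfl⟩ := Int.le.dest hi
    exact (e.isIso_liftExtend_f_iff _ hlift (i := k) (by simp [e])).2 inferInstance
  have : Epi g := HomologicalComplex.epi_of_epi_f _ fun i ↦ by
    by_cases hi : i ≤ n
    · have := hiso i hi
      infer_instance
    · exact ⟨fun _ _ _ ↦ (hzero i (by lia)).eq_of_src _ _⟩
  have hS : (ShortComplex.mk (kernel.ι g) g (kernel.condition g)).ShortExact :=
    { exact := ShortComplex.exact_kernel g }
  have hS' (i : ℤ) := hS.map_of_exact (HomologicalComplex.eval A (.up ℤ) i)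
  refine ⟨_, _, _, _, _, hS, fun i hi ↦ ?_, fun i hi ↦ ?_, hzero, fun i hi ↦ ?_⟩
  · have := hiso i hi
    exact (hS' i).isIso_g_iff.1 this
  · have : IsIso ((kernel.ι g).f i) := (hS' i).isIso_f_iff.2 (hzero i hi)
    exact ⟨asIso ((kernel.ι g).f i)⟩
  · have := hiso i hi
    exact ⟨(asIso (g.f i)).symm⟩

end CochainComplex

namespace DerivedCategory

open Pretriangulated

variable {A : Type u₁} [Category.{v₁} A] [Abelian A] [HasDerivedCategory.{w₁} A]

lemma isIso_homologyFunctor_map_mor₁ (T : Triangle (DerivedCategory A)) (hT : T ∈ distTriang _)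
    (i j : ℤ) (hij : i + 1 = j) (hi : IsZero ((homologyFunctor A i).obj T.obj₃))
    (hj : IsZero ((homologyFunctor A j).obj T.obj₃)) :
    IsIso ((homologyFunctor A j).map T.mor₁) := by
  have := (HomologySequence.mono_homologyMap_mor₁_iff T hT i j hij).2 (hi.eq_of_src _ _)
  have := (HomologySequence.epi_homologyMap_mor₁_iff T hT j).2 (hj.eq_of_tgt _ _)
  exact isIso_of_mono_of_epi _

lemma isIso_homologyFunctor_map_mor₂ (T : Triangle (DerivedCategory A)) (hT : T ∈ distTriang _)
    (i j : ℤ) (hij : i + 1 = j) (hi : IsZero ((homologyFunctor A i).obj T.obj₁))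
    (hj : IsZero ((homologyFunctor A j).obj T.obj₁)) :
    IsIso ((homologyFunctor A i).map T.mor₂) := by
  have := (HomologySequence.mono_homologyMap_mor₂_iff T hT i).2 (hi.eq_of_src _ _)
  have := (HomologySequence.epi_homologyMap_mor₂_iff T hT i j hij).2 (hj.eq_of_tgt _ _)
  exact isIso_of_mono_of_epi _

end DerivedCategory

end

open Pretriangulated DerivedCategory

/-! ### Truncation triangles and dévissage of bounded objects -/

noncomputable section

namespace DReflexivity

variable {A : Type u₁} [Category.{v₁} A] [Abelian A] [HasDerivedCategory.{w₁} A]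

/-- The homology objects of the canonical truncations of an object of the derived category. -/
lemma exists_canonicalTruncation (X : DerivedCategory A) (n : ℤ) :
    ∃ (T : Triangle (DerivedCategory A)) (_ : T ∈ distTriang _) (_ : T.obj₂ = X),
      T.obj₁.IsLE n ∧ T.obj₃.IsGE (n + 1) ∧
      (∀ i ≤ n, Nonempty ((homologyFunctor A i).obj T.obj₁ ≅ (homologyFunctor A i).obj X)) ∧
      (∀ i, n < i →
        Nonempty ((homologyFunctor A i).obj T.obj₃ ≅ (homologyFunctor A i).obj X)) := by
  obtain ⟨X₁, X₃, h₁, h₃, f, g, h, hT⟩ := TStructure.t.exists_triangle X n (n + 1) rfl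
  have h₁ : X₁.IsLE n := ⟨h₁⟩
  have h₃ : X₃.IsGE (n + 1) := ⟨h₃⟩
  refine ⟨_, hT, rfl, h₁, h₃, fun i hi ↦ ?_, fun i hi ↦ ?_⟩
  · have : IsIso ((homologyFunctor A i).map f) := isIso_homologyFunctor_map_mor₁ _ hT
      (i - 1) i (by lia) (X₃.isZero_of_isGE (n + 1) _ (by lia)) (X₃.isZero_of_isGE (n + 1) _ (by lia))
    exact ⟨@asIso _ _ _ _ ((homologyFunctor A i).map f) this⟩
  · have : IsIso ((homologyFunctor A i).map g) := isIso_homologyFunctor_map_mor₂ _ hT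
      i (i + 1) (by lia) (X₁.isZero_of_isLE n _ (by lia)) (X₁.isZero_of_isLE n _ (by lia))
    exact ⟨(asIso ((homologyFunctor A i).map g)).symm⟩

/-- The triangle in the derived category attached to a brutal truncation. -/
lemma exists_brutalTruncation (K : CochainComplex A ℤ) (n : ℤ) :
    ∃ (K₁ K₃ : CochainComplex A ℤ) (T : Triangle (DerivedCategory A)) (_ : T ∈ distTriang _)
      (_ : T.obj₁ = Q.obj K₁) (_ : T.obj₂ = Q.obj K) (_ : T.obj₃ = Q.obj K₃),
      (∀ i ≤ n, IsZero (K₁.X i)) ∧ (∀ i, n < i → Nonempty (K₁.X i ≅ K.X i)) ∧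
      (∀ i, n < i → IsZero (K₃.X i)) ∧ (∀ i ≤ n, Nonempty (K₃.X i ≅ K.X i)) := by
  obtain ⟨K₁, K₃, f, g, w, hS, h⟩ := K.exists_shortExact_brutalTruncation n
  exact ⟨K₁, K₃, _, triangleOfSES_distinguished hS, rfl, rfl, rfl, h⟩

section TriangulatedProperty

variable (R : ObjectProperty (DerivedCategory A)) [R.IsClosedUnderIsomorphisms]

variable {R} in
lemma prop_singleFunctor_of_iso {M N : A} (e : M ≅ N) (hM : R ((singleFunctor A 0).obj M)) :
    R ((singleFunctor A 0).obj N) :=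
  R.prop_of_iso ((singleFunctor A 0).mapIso e) hM

variable [R.IsTriangulated]

lemma prop_singleFunctor_obj {M : A} (hM : R ((singleFunctor A 0).obj M)) (n : ℤ) :
    R ((singleFunctor A n).obj M) :=
  R.prop_of_iso (((singleFunctors A).shiftIso (-n) n 0 (by lia)).app M) (R.le_shift (-n) _ hM)

lemma prop_singleFunctor_of_isZero {M : A} (hM : IsZero M) : R ((singleFunctor A 0).obj M) :=
  R.prop_of_isZero ((singleFunctor A 0).map_isZero hM)

/-- Induction on the amplitude `n`: truncating at `a` splits off the lowest cohomology object as a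
shifted stalk. -/
lemma prop_of_homology_aux (n : ℕ) (a : ℤ) (X : DerivedCategory A) (_ : X.IsGE a)
    (_ : X.IsLE (a + n)) (hX : ∀ i, R ((singleFunctor A 0).obj ((homologyFunctor A i).obj X))) :
    R X := by
  induction n generalizing a X with
  | zero =>
    have : X.IsLE a := by simpa using ‹X.IsLE (a + (0 : ℕ))›
    obtain ⟨M, ⟨e⟩⟩ := X.exists_iso_singleFunctor_obj_of_isGE_of_isLE a
    refine R.prop_of_iso e.symm (prop_singleFunctor_obj R ?_ a)
    exact prop_singleFunctor_of_iso ((homologyFunctor A a).mapIso e ≪≫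
      (singleFunctorCompHomologyFunctorIso A a).app M) (hX a)
  | succ n hn =>
    obtain ⟨T, hT, rfl, h₁, h₃, e₁, e₃⟩ := exists_canonicalTruncation X a
    have h₁' : T.obj₁.IsGE a := (isGE_iff _ _).2 fun i hi ↦
      (T.obj₂.isZero_of_isGE a i hi).of_iso (e₁ i hi.le).some
    have h₃' : T.obj₃.IsLE (a + 1 + n) := (isLE_iff _ _).2 fun i hi ↦
      (T.obj₂.isZero_of_isLE (a + (n + 1 : ℕ)) i (by push_cast; lia)).of_iso (e₃ i (by lia)).some
    refine R.ext_of_isTriangulatedClosed₂ T hT ?_ (hn (a + 1) _ h₃ h₃' fun i ↦ ?_)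
    · obtain ⟨M, ⟨e⟩⟩ := T.obj₁.exists_iso_singleFunctor_obj_of_isGE_of_isLE a
      refine R.prop_of_iso e.symm (prop_singleFunctor_obj R ?_ a)
      exact prop_singleFunctor_of_iso ((e₁ a le_rfl).some.symm ≪≫ (homologyFunctor A a).mapIso e ≪≫
        (singleFunctorCompHomologyFunctorIso A a).app M) (hX a)
    · by_cases hi : a < i
      · exact prop_singleFunctor_of_iso (e₃ i hi).some.symm (hX i)
      · exact prop_singleFunctor_of_isZero R (T.obj₃.isZero_of_isGE (a + 1) i (by lia))

/-- An object with bounded cohomology belongs to any triangulated subcategory which contains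
its cohomology objects. -/
lemma prop_of_homology (X : DerivedCategory A) (a b : ℤ) (_ : X.IsGE a) (_ : X.IsLE b)
    (hX : ∀ i, R ((singleFunctor A 0).obj ((homologyFunctor A i).obj X))) : R X :=
  -- If `b < a`, the amplitude becomes `0`; the upper bound `a` is then weaker than `b`.
  prop_of_homology_aux R (b - a).toNat a X inferInstance
    (TStructure.t.isLE_of_le X b (a + (b - a).toNat) (by lia)) hX

/-- Induction on the length: the brutal truncation at `a` has the lowest term as quotient and a
shorter complex as subobject. -/
lemma prop_Q_obj_aux (n : ℕ) (a : ℤ) (K : CochainComplex A ℤ) (_ : K.IsStrictlyGE a)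
    (_ : K.IsStrictlyLE (a + n)) (hK : ∀ i, R ((singleFunctor A 0).obj (K.X i))) :
    R (Q.obj K) := by
  have key (a : ℤ) (L : CochainComplex A ℤ) (_ : L.IsStrictlyGE a) (_ : L.IsStrictlyLE a)
      (hL : R ((singleFunctor A 0).obj (L.X a))) : R (Q.obj L) := by
    obtain ⟨M, ⟨e⟩⟩ := CochainComplex.exists_iso_single L a
    refine R.prop_of_iso (Q.mapIso e).symm (prop_singleFunctor_obj R ?_ a)
    exact prop_singleFunctor_of_iso ((HomologicalComplex.eval A _ a).mapIso e ≪≫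
      HomologicalComplex.singleObjXSelf (.up ℤ) a M) hL
  induction n generalizing a K with
  | zero => exact key a K inferInstance (by simpa using ‹K.IsStrictlyLE (a + (0 : ℕ))›) (hK a)
  | succ n hn =>
    obtain ⟨K₁, K₃, T, hT, e₁, e₂, e₃, z₁, i₁, z₃, i₃⟩ := exists_brutalTruncation K a
    rw [← e₂]
    refine R.ext_of_isTriangulatedClosed₂ T hT ?_ ?_
    · rw [e₁]
      refine hn (a + 1) K₁ ?_ ?_ fun i ↦ ?_
      · exact (CochainComplex.isStrictlyGE_iff _ _).2 fun i hi ↦ z₁ i (by lia)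
      · exact (CochainComplex.isStrictlyLE_iff _ _).2 fun i hi ↦
          (K.isZero_of_isStrictlyLE (a + (n + 1 : ℕ)) i (by push_cast; lia)).of_iso
            (i₁ i (by lia)).some
      · by_cases hi : a < i
        · exact prop_singleFunctor_of_iso (i₁ i hi).some.symm (hK i)
        · exact prop_singleFunctor_of_isZero R (z₁ i (by lia))
    · rw [e₃]
      refine key a K₃ ?_ ?_ (prop_singleFunctor_of_iso (i₃ a le_rfl).some.symm (hK a))
      · exact (CochainComplex.isStrictlyGE_iff _ _).2 fun i hi ↦
          (K.isZero_of_isStrictlyGE a i hi).of_iso (i₃ i hi.le).some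
      · exact (CochainComplex.isStrictlyLE_iff _ _).2 z₃

/-- A bounded complex belongs to any triangulated subcategory which contains its terms. -/
lemma prop_Q_obj (K : CochainComplex A ℤ) (a b : ℤ) (_ : K.IsStrictlyGE a) (_ : K.IsStrictlyLE b)
    (hK : ∀ i, R ((singleFunctor A 0).obj (K.X i))) : R (Q.obj K) :=
  prop_Q_obj_aux R (b - a).toNat a K inferInstance
    (K.isStrictlyLE_of_le b (a + (b - a).toNat) (by lia)) hK

end TriangulatedProperty

/-! ### Testing a natural transformation one cohomology degree at a time -/

section WayOut

variable {P : ObjectProperty (DerivedCategory A)}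
  {E : P.FullSubcategory ⥤ P.FullSubcategory} (η : 𝟭 _ ⟶ E)

/-- The objects of a full subcategory of the derived category at which a natural transformation
is an isomorphism, as objects of the derived category. -/
abbrev reflexives : ObjectProperty (DerivedCategory A) := (NatTrans.isIsoLocus η).map P.ι

lemma reflexives_iff (Z : DerivedCategory A) [P.IsClosedUnderIsomorphisms] :
    reflexives η Z ↔ ∃ hZ : P Z, IsIso (η.app ⟨Z, hZ⟩) := by
  constructor
  · rintro ⟨X, hX, ⟨e⟩⟩
    have hZ : P Z := P.prop_of_iso e X.property
    exact ⟨hZ, (NatTrans.isIsoLocus η).prop_of_iso (P.isoMk e : X ≅ ⟨Z, hZ⟩) hX⟩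
  · rintro ⟨hZ, h⟩
    exact ⟨⟨Z, hZ⟩, h, ⟨Iso.refl _⟩⟩

lemma isIso_app_iff (X : P.FullSubcategory) :
    IsIso (η.app X) ↔ ∀ i, IsIso ((homologyFunctor A i).map (η.app X).hom) := by
  rw [← DerivedCategory.isIso_iff]
  exact (isIso_iff_of_reflects_iso (η.app X) P.ι).symm

/-- Two opposite sides of the naturality square become isomorphisms on `H^i`. -/
lemma isIso_homologyFunctor_map_app_iff {X Y : P.FullSubcategory} (f : X ⟶ Y) (i : ℤ)
    (_ : IsIso ((homologyFunctor A i).map f.hom))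
    (_ : IsIso ((homologyFunctor A i).map (E.map f).hom)) :
    IsIso ((homologyFunctor A i).map (η.app X).hom) ↔
      IsIso ((homologyFunctor A i).map (η.app Y).hom) := by
  have h : (homologyFunctor A i).map f.hom ≫ (homologyFunctor A i).map (η.app Y).hom =
      (homologyFunctor A i).map (η.app X).hom ≫ (homologyFunctor A i).map (E.map f).hom := by
    rw [← Functor.map_comp, ← Functor.map_comp]
    exact congrArg (fun φ ↦ (homologyFunctor A i).map φ.hom) (η.naturality f)
  rw [← isIso_comp_right_iff _ ((homologyFunctor A i).map (E.map f).hom), ← h,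
    isIso_comp_left_iff]

variable [P.IsTriangulated] [P.IsClosedUnderIsomorphisms] [E.CommShift ℤ] [E.IsTriangulated]

/-- The triangle may vary with the degree, so no single truncation has to work for all of `X`.
Membership of `T.obj₃` in `P`, needed to apply `E`, follows from that of the other two vertices. -/
lemma reflexives_of_obj₁ (X : P.FullSubcategory)
    (hX : ∀ i : ℤ, ∃ (T : Triangle (DerivedCategory A)) (_ : T ∈ distTriang _)
      (_ : T.obj₂ = X.obj), reflexives η T.obj₁ ∧ ∀ h₃ : P T.obj₃, ∀ j, i ≤ j → j ≤ i + 1 →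
        IsZero ((homologyFunctor A j).obj T.obj₃) ∧
        IsZero ((homologyFunctor A j).obj (E.obj ⟨T.obj₃, h₃⟩).obj)) :
    reflexives η X.obj := by
  refine (reflexives_iff η _).2 ⟨X.property, (isIso_app_iff η X).2 fun i ↦ ?_⟩
  obtain ⟨X, hP⟩ := X
  -- `H^i(T.obj₁) ⟶ H^i(T.obj₂)` is flanked by `H^(i-1)` and `H^i` of `T.obj₃`.
  obtain ⟨T, hT, rfl, h₁, h⟩ := hX (i - 1)
  obtain ⟨hP₁, h₁⟩ := (reflexives_iff η _).1 h₁
  have hP₃ : P T.obj₃ := P.ext_of_isTriangulatedClosed₃ T hT hP₁ hP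
  have hT' := P.liftTriangle_distinguished T hT hP₁ hP hP₃
  have h := h hP₃
  exact (isIso_homologyFunctor_map_app_iff η (P.liftTriangle T hP₁ hP hP₃).mor₁ i
    (isIso_homologyFunctor_map_mor₁ T hT (i - 1) i (by lia)
      (h _ (by lia) (by lia)).1 (h _ (by lia) (by lia)).1)
    (isIso_homologyFunctor_map_mor₁ _ (P.ι.map_distinguished _ (E.map_distinguished _ hT'))
      (i - 1) i (by lia) (h _ (by lia) (by lia)).2 (h _ (by lia) (by lia)).2)).1
    ((isIso_app_iff η _).1 h₁ i)

lemma reflexives_of_obj₃ (X : P.FullSubcategory)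
    (hX : ∀ i : ℤ, ∃ (T : Triangle (DerivedCategory A)) (_ : T ∈ distTriang _)
      (_ : T.obj₂ = X.obj), reflexives η T.obj₃ ∧ ∀ h₁ : P T.obj₁, ∀ j, i ≤ j → j ≤ i + 1 →
        IsZero ((homologyFunctor A j).obj T.obj₁) ∧
        IsZero ((homologyFunctor A j).obj (E.obj ⟨T.obj₁, h₁⟩).obj)) :
    reflexives η X.obj := by
  refine (reflexives_iff η _).2 ⟨X.property, (isIso_app_iff η X).2 fun i ↦ ?_⟩
  obtain ⟨X, hP⟩ := X
  -- Here the flanking terms are `H^i` and `H^(i+1)` of `T.obj₁`.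
  obtain ⟨T, hT, rfl, h₃, h⟩ := hX i
  obtain ⟨hP₃, h₃⟩ := (reflexives_iff η _).1 h₃
  have hP₁ : P T.obj₁ := P.ext_of_isTriangulatedClosed₁ T hT hP hP₃
  have hT' := P.liftTriangle_distinguished T hT hP₁ hP hP₃
  have h := h hP₁
  exact (isIso_homologyFunctor_map_app_iff η (P.liftTriangle T hP₁ hP hP₃).mor₂ i
    (isIso_homologyFunctor_map_mor₂ T hT i (i + 1) (by lia)
      (h _ (by lia) (by lia)).1 (h _ (by lia) (by lia)).1)
    (isIso_homologyFunctor_map_mor₂ _ (P.ι.map_distinguished _ (E.map_distinguished _ hT'))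
      i (i + 1) (by lia) (h _ (by lia) (by lia)).2 (h _ (by lia) (by lia)).2)).2
    ((isIso_app_iff η _).1 h₃ i)

end WayOut

end DReflexivity

end

open Pretriangulated DerivedCategory

/-! ### Way-out functors and unbounded objects -/

noncomputable section

namespace DReflexivity

variable {A : Type u₁} [Category.{v₁} A] [Abelian A]

/-- A complex whose nonzero terms are terms of a complex satisfying a boundedness condition
satisfies this condition. -/
lemma complexes_of_terms (s : Bd) (K L : CochainComplex A ℤ)
    (h : ∀ i, IsZero (L.X i) ∨ Nonempty (L.X i ≅ K.X i)) (hK : s.complexes A K) :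
    s.complexes A L := by
  have hz (i : ℤ) (hi : IsZero (K.X i)) : IsZero (L.X i) :=
    (h i).elim id fun ⟨e⟩ ↦ hi.of_iso e
  have hplus : (∃ n : ℤ, K.IsStrictlyGE n) → ∃ n : ℤ, L.IsStrictlyGE n := fun ⟨n, _⟩ ↦
    ⟨n, (CochainComplex.isStrictlyGE_iff _ _).2 fun i hi ↦ hz i (K.isZero_of_isStrictlyGE n i hi)⟩
  have hminus : (∃ n : ℤ, K.IsStrictlyLE n) → ∃ n : ℤ, L.IsStrictlyLE n := fun ⟨n, _⟩ ↦
    ⟨n, (CochainComplex.isStrictlyLE_iff _ _).2 fun i hi ↦ hz i (K.isZero_of_isStrictlyLE n i hi)⟩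
  cases s
  · trivial
  · exact hplus hK
  · exact hminus hK
  · exact ⟨hplus hK.1, hminus hK.2⟩

variable [HasDerivedCategory.{w₁} A]

section WayOut

variable {P : ObjectProperty (DerivedCategory A)} [P.IsTriangulated]
  {E : P.FullSubcategory ⥤ P.FullSubcategory} [E.CommShift ℤ]

/-- The shift of an object of a triangulated subcategory, computed before and after applying
an endofunctor which commutes with the shifts. -/
def objShiftIso (X : P.FullSubcategory) (n : ℤ) :
    (E.obj (X⟦n⟧)).obj ≅ (E.obj X).obj⟦n⟧ :=
  P.ι.mapIso ((E.commShiftIso n).app X) ≪≫ (P.ι.commShiftIso n).app (E.obj X)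

lemma exists_isZero_homology_of_wayOutLeft
    (hE : ∃ n : ℤ, ∀ X : P.FullSubcategory, X.obj.IsLE 0 → (E.obj X).obj.IsLE n) (i : ℤ) :
    ∃ m : ℤ, ∀ Z, Z.IsLE m → ∀ hZ : P Z, ∀ j, i ≤ j →
      IsZero ((homologyFunctor A j).obj Z) ∧
        IsZero ((homologyFunctor A j).obj (E.obj ⟨Z, hZ⟩).obj) := by
  obtain ⟨n, hn⟩ := hE
  -- Shifting by `m` reduces to the bound `0`: if `Z` lives in degrees at most `m`, then `E Z` lives
  -- in degrees at most `m + n`. Both `m` and `m + n` must be below `i`.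
  refine ⟨min (i - 1) (i - 1 - n), fun Z h hZ j hj ↦ ?_⟩
  generalize hm : min (i - 1) (i - 1 - n) = m at h
  have h' : (E.obj ((⟨Z, hZ⟩ : P.FullSubcategory)⟦m⟧)).obj.IsLE n := by
    have := TStructure.t.isLE_shift Z m m 0
    exact hn _ (TStructure.t.isLE_of_iso (show Z⟦m⟧ ≅ _ from
      (P.ι.commShiftIso m).symm.app ⟨Z, hZ⟩) 0)
  have := TStructure.t.isLE_of_iso (objShiftIso (E := E) ⟨Z, hZ⟩ m) n
  have := TStructure.t.isLE_of_shift (E.obj ⟨Z, hZ⟩).obj (m + n) m n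
  exact ⟨Z.isZero_of_isLE m j (by lia), isZero_of_isLE _ (m + n) j (by lia)⟩

lemma exists_isZero_homology_of_wayOutRight
    (hE : ∃ n : ℤ, ∀ X : P.FullSubcategory, X.obj.IsGE 0 → (E.obj X).obj.IsGE n) (i : ℤ) :
    ∃ m : ℤ, ∀ Z, Z.IsGE m → ∀ hZ : P Z, ∀ j, j ≤ i →
      IsZero ((homologyFunctor A j).obj Z) ∧
        IsZero ((homologyFunctor A j).obj (E.obj ⟨Z, hZ⟩).obj) := by
  obtain ⟨n, hn⟩ := hE
  refine ⟨max (i + 1) (i + 1 - n), fun Z h hZ j hj ↦ ?_⟩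
  generalize hm : max (i + 1) (i + 1 - n) = m at h
  have h' : (E.obj ((⟨Z, hZ⟩ : P.FullSubcategory)⟦m⟧)).obj.IsGE n := by
    have := TStructure.t.isGE_shift Z m m 0
    exact hn _ (TStructure.t.isGE_of_iso (show Z⟦m⟧ ≅ _ from
      (P.ι.commShiftIso m).symm.app ⟨Z, hZ⟩) 0)
  have := TStructure.t.isGE_of_iso (objShiftIso (E := E) ⟨Z, hZ⟩ m) n
  have := TStructure.t.isGE_of_shift (E.obj ⟨Z, hZ⟩).obj (m + n) m n
  exact ⟨Z.isZero_of_isGE m j (by lia), isZero_of_isGE _ (m + n) j (by lia)⟩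

variable [P.IsClosedUnderIsomorphisms] [E.IsTriangulated] (η : 𝟭 _ ⟶ E)
  [NatTrans.CommShift η ℤ]

/-- The high-degree part of a brutal truncation is the subcomplex, here bounded; the discarded
low-degree part is the quotient. -/
lemma reflexives_Q_obj_of_wayOutLeft
    (hE : ∃ n : ℤ, ∀ X : P.FullSubcategory, X.obj.IsLE 0 → (E.obj X).obj.IsLE n)
    (K : CochainComplex A ℤ) (hP : P (Q.obj K)) (b : ℤ) (_ : K.IsStrictlyLE b)
    (hK : ∀ i, reflexives η ((singleFunctor A 0).obj (K.X i))) : reflexives η (Q.obj K) := by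
  refine reflexives_of_obj₁ η ⟨_, hP⟩ fun i ↦ ?_
  obtain ⟨m, hm⟩ := exists_isZero_homology_of_wayOutLeft hE i
  obtain ⟨K₁, K₃, T, hT, e₁, e₂, e₃, z₁, i₁, z₃, i₃⟩ := exists_brutalTruncation K m
  have : K₃.IsStrictlyLE m := (CochainComplex.isStrictlyLE_iff _ _).2 z₃
  refine ⟨T, hT, e₂, ?_, fun h₃ j hj _ ↦ hm _ (by rw [e₃]; infer_instance) h₃ j hj⟩
  rw [e₁]
  refine prop_Q_obj _ K₁ (m + 1) b ?_ ?_ fun j ↦ ?_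
  · exact (CochainComplex.isStrictlyGE_iff _ _).2 fun j hj ↦ z₁ j (by lia)
  · refine (CochainComplex.isStrictlyLE_iff _ _).2 fun j hj ↦ ?_
    by_cases h : m < j
    · exact (K.isZero_of_isStrictlyLE b j hj).of_iso (i₁ j h).some
    · exact z₁ j (by lia)
  · by_cases h : m < j
    · exact prop_singleFunctor_of_iso (i₁ j h).some.symm (hK j)
    · exact prop_singleFunctor_of_isZero _ (z₁ j (by lia))

lemma reflexives_Q_obj_of_wayOutRight
    (hE : ∃ n : ℤ, ∀ X : P.FullSubcategory, X.obj.IsGE 0 → (E.obj X).obj.IsGE n)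
    (K : CochainComplex A ℤ) (hP : P (Q.obj K)) (a : ℤ) (_ : K.IsStrictlyGE a)
    (hK : ∀ i, reflexives η ((singleFunctor A 0).obj (K.X i))) : reflexives η (Q.obj K) := by
  refine reflexives_of_obj₃ η ⟨_, hP⟩ fun i ↦ ?_
  -- Vanishing is needed up to degree `i + 1`. Cutting at `m - 1` puts the discarded subcomplex in
  -- degrees at least `m`.
  obtain ⟨m, hm⟩ := exists_isZero_homology_of_wayOutRight hE (i + 1)
  obtain ⟨K₁, K₃, T, hT, e₁, e₂, e₃, z₁, i₁, z₃, i₃⟩ := exists_brutalTruncation K (m - 1)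
  have : K₁.IsStrictlyGE m := (CochainComplex.isStrictlyGE_iff _ _).2 fun j hj ↦ z₁ j (by lia)
  refine ⟨T, hT, e₂, ?_, fun h₁ j _ hj ↦ hm _ (by rw [e₁]; infer_instance) h₁ j hj⟩
  rw [e₃]
  refine prop_Q_obj _ K₃ a (m - 1) ?_ ?_ fun j ↦ ?_
  · refine (CochainComplex.isStrictlyGE_iff _ _).2 fun j hj ↦ ?_
    by_cases h : j ≤ m - 1
    · exact (K.isZero_of_isStrictlyGE a j hj).of_iso (i₃ j h).some
    · exact z₃ j (by lia)
  · exact (CochainComplex.isStrictlyLE_iff _ _).2 z₃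
  · by_cases h : j ≤ m - 1
    · exact prop_singleFunctor_of_iso (i₃ j h).some.symm (hK j)
    · exact prop_singleFunctor_of_isZero _ (z₃ j (by lia))

/-- In a canonical truncation the low-degree part comes first, so the vertices exchange the roles
they have for brutal truncations. -/
lemma reflexives_of_homology_of_wayOutLeft
    (hE : ∃ n : ℤ, ∀ X : P.FullSubcategory, X.obj.IsLE 0 → (E.obj X).obj.IsLE n)
    (X : DerivedCategory A) (hP : P X) (b : ℤ) (_ : X.IsLE b)
    (hX : ∀ i, reflexives η ((singleFunctor A 0).obj ((homologyFunctor A i).obj X))) :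
    reflexives η X := by
  refine reflexives_of_obj₃ η ⟨X, hP⟩ fun i ↦ ?_
  obtain ⟨m, hm⟩ := exists_isZero_homology_of_wayOutLeft hE i
  obtain ⟨T, hT, rfl, h₁, h₃, e₁, e₃⟩ := exists_canonicalTruncation X m
  refine ⟨T, hT, rfl, ?_, fun hP₁ j hj _ ↦ hm _ h₁ hP₁ j hj⟩
  refine prop_of_homology _ T.obj₃ (m + 1) b h₃ ((isLE_iff _ _).2 fun j hj ↦ ?_) fun j ↦ ?_
  · by_cases h : m < j
    · exact (T.obj₂.isZero_of_isLE b j hj).of_iso (e₃ j h).some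
    · exact T.obj₃.isZero_of_isGE (m + 1) j (by lia)
  · by_cases h : m < j
    · exact prop_singleFunctor_of_iso (e₃ j h).some.symm (hX j)
    · exact prop_singleFunctor_of_isZero _ (T.obj₃.isZero_of_isGE (m + 1) j (by lia))

lemma reflexives_of_homology_of_wayOutRight
    (hE : ∃ n : ℤ, ∀ X : P.FullSubcategory, X.obj.IsGE 0 → (E.obj X).obj.IsGE n)
    (X : DerivedCategory A) (hP : P X) (a : ℤ) (_ : X.IsGE a)
    (hX : ∀ i, reflexives η ((singleFunctor A 0).obj ((homologyFunctor A i).obj X))) :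
    reflexives η X := by
  refine reflexives_of_obj₁ η ⟨X, hP⟩ fun i ↦ ?_
  obtain ⟨m, hm⟩ := exists_isZero_homology_of_wayOutRight hE (i + 1)
  obtain ⟨T, hT, rfl, h₁, h₃, e₁, e₃⟩ := exists_canonicalTruncation X m
  refine ⟨T, hT, rfl, ?_, fun hP₃ j _ hj ↦
    hm _ (TStructure.t.isGE_of_ge _ m (m + 1)) hP₃ j hj⟩
  refine prop_of_homology _ T.obj₁ a m ((isGE_iff _ _).2 fun j hj ↦ ?_) h₁ fun j ↦ ?_
  · by_cases h : j ≤ m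
    · exact (T.obj₂.isZero_of_isGE a j hj).of_iso (e₁ j h).some
    · exact T.obj₁.isZero_of_isLE m j (by lia)
  · by_cases h : j ≤ m
    · exact prop_singleFunctor_of_iso (e₁ j h).some.symm (hX j)
    · exact prop_singleFunctor_of_isZero _ (T.obj₁.isZero_of_isLE m j (by lia))

end WayOut

/-- The derived category with a boundedness condition is stable under canonical truncations. -/
lemma derived_obj₁_and_obj₃ (s : Bd) (T : Triangle (DerivedCategory A)) (hT : T ∈ distTriang _)
    (m n : ℤ) (_ : T.obj₁.IsLE m) (_ : T.obj₃.IsGE n) (h₂ : s.derived A T.obj₂) :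
    s.derived A T.obj₁ ∧ s.derived A T.obj₃ := by
  let t := DerivedCategory.TStructure.t (C := A)
  -- Each outer vertex has one bound from the truncation; the other bound, when required, follows by
  -- two out of three.
  have h₁ : t.minus T.obj₁ := ⟨m, inferInstance⟩
  have h₃ : t.plus T.obj₃ := ⟨n, inferInstance⟩
  have hplus (h : t.plus T.obj₂) : t.plus T.obj₁ :=
    t.plus.ext_of_isTriangulatedClosed₁ T hT h h₃
  have hminus (h : t.minus T.obj₂) : t.minus T.obj₃ :=
    t.minus.ext_of_isTriangulatedClosed₃ T hT h₁ h
  cases s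
  · exact ⟨trivial, trivial⟩
  · exact ⟨hplus h₂, h₃⟩
  · exact ⟨h₁, hminus h₂⟩
  · exact ⟨⟨hplus h₂.1, h₁⟩, ⟨h₃, hminus h₂.2⟩⟩

section TwoSided

variable {s : Bd} {E : DStar A s ⥤ DStar A s} [E.CommShift ℤ] [E.IsTriangulated]
  (η : 𝟭 _ ⟶ E) [NatTrans.CommShift η ℤ]
  (hL : ∃ n : ℤ, ∀ X : DStar A s, X.obj.IsLE 0 → (E.obj X).obj.IsLE n)
  (hR : ∃ n : ℤ, ∀ X : DStar A s, X.obj.IsGE 0 → (E.obj X).obj.IsGE n)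

include hL hR

/-- Terms in positive degrees are handled by way-out right, the others by way-out left; both halves
stay in `D^s(A)` because their nonzero terms are terms of `K`. -/
lemma reflexives_Q_obj_of_wayOut (K : CochainComplex A ℤ) (hs : s.complexes A K)
    (hK : ∀ i, reflexives η ((singleFunctor A 0).obj (K.X i))) : reflexives η (Q.obj K) := by
  obtain ⟨K₁, K₃, T, hT, e₁, e₂, e₃, z₁, i₁, z₃, i₃⟩ := exists_brutalTruncation K 0
  have t₁ (i : ℤ) : IsZero (K₁.X i) ∨ Nonempty (K₁.X i ≅ K.X i) :=
    (le_or_gt i 0).imp (z₁ i) (i₁ i)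
  have t₃ (i : ℤ) : IsZero (K₃.X i) ∨ Nonempty (K₃.X i ≅ K.X i) :=
    (lt_or_ge 0 i).imp (z₃ i) (i₃ i)
  have hM {M N : A} (hM : IsZero M ∨ Nonempty (M ≅ N))
      (hN : reflexives η ((singleFunctor A 0).obj N)) :
      reflexives η ((singleFunctor A 0).obj M) :=
    hM.elim (prop_singleFunctor_of_isZero _) fun ⟨e⟩ ↦ prop_singleFunctor_of_iso e.symm hN
  rw [← e₂]
  refine (reflexives η).ext_of_isTriangulatedClosed₂ T hT ?_ ?_
  · rw [e₁]
    exact reflexives_Q_obj_of_wayOutRight η hR K₁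
      (derived_Q_obj s _ (complexes_of_terms s K K₁ t₁ hs)) 1
      ((CochainComplex.isStrictlyGE_iff _ _).2 fun i hi ↦ z₁ i (by lia))
      fun i ↦ hM (t₁ i) (hK i)
  · rw [e₃]
    exact reflexives_Q_obj_of_wayOutLeft η hL K₃
      (derived_Q_obj s _ (complexes_of_terms s K K₃ t₃ hs)) 0
      ((CochainComplex.isStrictlyLE_iff _ _).2 z₃) fun i ↦ hM (t₃ i) (hK i)

lemma reflexives_of_homology_of_wayOut (X : DerivedCategory A) (hs : s.derived A X)
    (hX : ∀ i, reflexives η ((singleFunctor A 0).obj ((homologyFunctor A i).obj X))) :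
    reflexives η X := by
  obtain ⟨T, hT, rfl, h₁, h₃, e₁, e₃⟩ := exists_canonicalTruncation X 0
  obtain ⟨hs₁, hs₃⟩ := derived_obj₁_and_obj₃ s T hT 0 (0 + 1) h₁ h₃ hs
  refine (reflexives η).ext_of_isTriangulatedClosed₂ T hT
    (reflexives_of_homology_of_wayOutLeft η hL _ hs₁ 0 h₁ fun i ↦ ?_)
    (reflexives_of_homology_of_wayOutRight η hR _ hs₃ (0 + 1) h₃ fun i ↦ ?_)
  · by_cases hi : i ≤ 0
    · exact prop_singleFunctor_of_iso (e₁ i hi).some.symm (hX i)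
    · exact prop_singleFunctor_of_isZero _ (T.obj₁.isZero_of_isLE 0 i (by lia))
  · by_cases hi : 0 < i
    · exact prop_singleFunctor_of_iso (e₃ i hi).some.symm (hX i)
    · exact prop_singleFunctor_of_isZero _ (T.obj₃.isZero_of_isGE (0 + 1) i (by lia))

end TwoSided

end DReflexivity

end

/-! ### The theorem -/

theorem theorem3p1
    {A : Type u₁} [Category.{v₁} A] [Abelian A] [HasDerivedCategory.{w₁} A]
    {B : Type u₂} [Category.{v₂} B] [Abelian B] [HasDerivedCategory.{w₂} B]
    -- a right adjoint pair of contravariant additive functors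
    (Φ : Aᵒᵖ ⥤ B) (Ψ : Bᵒᵖ ⥤ A) [Φ.Additive] [Ψ.Additive] (adj : Φ.rightOp ⊣ Ψ)
    -- their derived functors on `D^s(A)` and `D^t(B)`, which are `δ`-functors
    (s t : Bd)
    (RΦ : (DStar A s)ᵒᵖ ⥤ DerivedCategory B) [RΦ.CommShift ℤ] [RΦ.IsTriangulated]
    (α : toDerived Φ s ⟶ (DStar.Qh A s).op ⋙ RΦ) (_ : IsRightDerived Φ s RΦ α)
    (RΨ : (DStar B t)ᵒᵖ ⥤ DerivedCategory A) [RΨ.CommShift ℤ] [RΨ.IsTriangulated]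
    (β : toDerived Ψ t ⟶ (DStar.Qh B t).op ⋙ RΨ) (_ : IsRightDerived Ψ t RΨ β)
    -- the induced adjunction between `RΦ : D^s(A) → D^t(B)` and `RΨ : D^t(B) → D^s(A)`
    (hΦ : ∀ X, t.derived B (RΦ.obj X)) (hΨ : ∀ Y, s.derived A (RΨ.obj Y))
    (Radj : (corestrict RΦ hΦ).rightOp ⊣ corestrict RΨ hΨ) (_ : IsInduced adj α β Radj) :
    -- (1)
    (∀ X : CochainComplex A ℤ, Bd.bounded.complexes A X →
      (∀ i, IsDReflexiveObj Radj (X.X i)) → IsDReflexive Radj (DerivedCategory.Q.obj X)) ∧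
    -- (2)
    (∀ X : DStar A s, Bd.bounded.derived A X.obj →
      (∀ i, IsDReflexiveObj Radj ((DerivedCategory.homologyFunctor A i).obj X.obj)) →
        IsDReflexive Radj X.obj) ∧
    (WayOutLeft ((corestrict RΦ hΦ).rightOp ⋙ RΨ) →
      -- (3), left
      (∀ X : CochainComplex A ℤ, s.complexes A X → Bd.minus.complexes A X →
        (∀ i, IsDReflexiveObj Radj (X.X i)) → IsDReflexive Radj (DerivedCategory.Q.obj X)) ∧
      -- (4), left
      (∀ X : DStar A s, Bd.minus.derived A X.obj →
        (∀ i, IsDReflexiveObj Radj ((DerivedCategory.homologyFunctor A i).obj X.obj)) →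
          IsDReflexive Radj X.obj)) ∧
    (WayOutRight ((corestrict RΦ hΦ).rightOp ⋙ RΨ) →
      -- (3), right
      (∀ X : CochainComplex A ℤ, s.complexes A X → Bd.plus.complexes A X →
        (∀ i, IsDReflexiveObj Radj (X.X i)) → IsDReflexive Radj (DerivedCategory.Q.obj X)) ∧
      -- (4), right
      (∀ X : DStar A s, Bd.plus.derived A X.obj →
        (∀ i, IsDReflexiveObj Radj ((DerivedCategory.homologyFunctor A i).obj X.obj)) →
          IsDReflexive Radj X.obj)) ∧
    (WayOutLeft ((corestrict RΦ hΦ).rightOp ⋙ RΨ) →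
      WayOutRight ((corestrict RΦ hΦ).rightOp ⋙ RΨ) →
      -- (5)
      (∀ X : CochainComplex A ℤ, s.complexes A X →
        (∀ i, IsDReflexiveObj Radj (X.X i)) → IsDReflexive Radj (DerivedCategory.Q.obj X)) ∧
      -- (6)
      (∀ X : DStar A s,
        (∀ i, IsDReflexiveObj Radj ((DerivedCategory.homologyFunctor A i).obj X.obj)) →
          IsDReflexive Radj X.obj)) := by
  -- Neither reflexivity nor the way-out conditions involve the shift isomorphisms of the composite,
  -- so any compatible choice may be used.
  obtain ⟨_, _, _⟩ := Radj.exists_commShift_unit_rightOp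
  have reflexive_iff : IsDReflexive Radj = reflexives Radj.unit :=
    funext fun Z ↦ propext (reflexives_iff Radj.unit Z).symm
  simp only [IsDReflexiveObj, reflexive_iff]
  refine ⟨?_, ?_, fun hL ↦ ⟨?_, ?_⟩, fun hR ↦ ⟨?_, ?_⟩, fun hL hR ↦ ⟨?_, ?_⟩⟩
  -- Membership in `D^s(A)` is part of `reflexives`, so it comes out of the dévissage together with
  -- the isomorphism.
  · rintro K ⟨⟨a, ha⟩, b, hb⟩ hK
    exact prop_Q_obj _ K a b ha hb hK
  · rintro X ⟨⟨a, ha⟩, b, hb⟩ hX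
    exact prop_of_homology _ X.obj a b ha hb hX
  · rintro K hs ⟨b, hb⟩ hK
    exact reflexives_Q_obj_of_wayOutLeft Radj.unit hL K (derived_Q_obj s K hs) b hb hK
  · rintro X ⟨b, hb⟩ hX
    exact reflexives_of_homology_of_wayOutLeft Radj.unit hL X.obj X.property b hb hX
  · rintro K hs ⟨a, ha⟩ hK
    exact reflexives_Q_obj_of_wayOutRight Radj.unit hR K (derived_Q_obj s K hs) a ha hK
  · rintro X ⟨a, ha⟩ hX
    exact reflexives_of_homology_of_wayOutRight Radj.unit hR X.obj X.property a ha hX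
  · exact fun K hs hK ↦ reflexives_Q_obj_of_wayOut Radj.unit hL hR K hs hK
  · exact fun X hX ↦ reflexives_of_homology_of_wayOut Radj.unit hL hR X.obj X.property hX
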